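/- Conventions. Finite subsets of $\mathbb{N}$ are identified with the strictly increasing sequences of their elements. For $s\in[\mathbb{N}]^{<\omega}$ and $X\subseteq\mathbb{N}$, write $s\le_{in}X$ if $s$ is an initial segment of $X$. For $s,t\in[\mathbb{N}]^{<\omega}$, write $s\triangleleft t$ if there is $r\in[\mathbb{N}]^{<\omega}$ such that $s$ is a proper initial segment of $r$ and $t$ is obtained from $r$ by deleting its least element. A *barrier* is an infinite set $B\subseteq[\mathbb{N}]^{<\omega}$, no member of which is properly included in another, such that every infinite subset $X$ of $\bigcup B$ has a nonempty initial segment $s\le_{in}X$ with $s\in B$. Every barrier is well-ordered by the lexicographic order, and its *order type* is the order type for this order. For a countable ordinal $\alpha$, a poset $Q$ is *$\alpha$-better-quasi-ordered* ($\alpha$-bqo) if for every barrier $B$ of order type at most $\alpha$ and every map $f:B\to Q$ there are $s,t\in B$ with $s\triangleleft t$ and $f(s)\le f(t)$. For a poset $P$, let $AM_2(P)$ be the set of maximal antichains of $P$ having exactly two elements, ordered by domination: $X\le Y$ if for every $x\in X$ there is $y\in Y$ with $x\le y$. Let $\bigcup AM_2(P)\subseteq P$ be the union of these antichains, with the order induced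 by $P$. **Theorem.** Let $P$ be a poset with no infinite antichain and let $\alpha$ be a countable ordinal. Then $AM_2(P)$ is $\alpha$-bqo if and only if $\bigcup AM_2(P)$ is $\alpha$-bqo. -/

import Mathlib

namespace BQO

/-- `s` is an initial segment of `X`, where sets of natural numbers are identified with the
strictly increasing enumeration of their elements. -/
def IsInit (s : Finset ℕ) (X : Set ℕ) : Prop :=
  (s : Set ℕ) ⊆ X ∧ ∀ x ∈ X, ∀ y ∈ s, x ≤ y → x ∈ s

/-- The finite set obtained from `r` by deleting its least element (the tail of `∅` is `∅`). -/
def tail (r : Finset ℕ) : Finset ℕ :=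
  r.filter (fun x => ∃ y ∈ r, y < x)

/-- The relation `s ◁ t`: some `r` has `s` as a proper initial segment and `t` as its tail. -/
def Shift (s t : Finset ℕ) : Prop :=
  ∃ r : Finset ℕ, IsInit s (r : Set ℕ) ∧ s ≠ r ∧ t = tail r

/-- The strict lexicographic order on finite sets of natural numbers, each listed in increasing
order. -/
def LexLT (s t : Finset ℕ) : Prop :=
  s.sort (· ≤ ·) < t.sort (· ≤ ·)

/-- The union of the members of `B`. -/
def dom (B : Set (Finset ℕ)) : Set ℕ :=
  {n | ∃ s ∈ B, n ∈ s}

/-- A block: an infinite set `B` of finite sets of natural numbers such that every infinite subset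
of the union of `B` has a nonempty initial segment in `B`. -/
def IsBlock (B : Set (Finset ℕ)) : Prop :=
  B.Infinite ∧
    ∀ X : Set ℕ, X ⊆ dom B → X.Infinite → ∃ s ∈ B, s.Nonempty ∧ IsInit s X

/-- A barrier: a block that is an antichain under inclusion. -/
def IsBarrier (B : Set (Finset ℕ)) : Prop :=
  IsBlock B ∧ IsAntichain (· ⊆ ·) B

/-- The set `B` is well-ordered by the lexicographic order and its order type is at most `α`.
(Every barrier is well-ordered by the lexicographic order.) -/
def LexTypeLE (B : Set (Finset ℕ)) (α : Ordinal.{0}) : Prop :=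
  ∃ h : IsWellOrder B (fun s t => LexLT s.1 t.1),
    @Ordinal.type B (fun s t => LexLT s.1 t.1) h ≤ α

/-- A map from (a barrier) `B` into `Q` is good if `f s ≤ f t` for some `s ◁ t` in `B`. -/
def IsGood {Q : Type*} [Preorder Q] {B : Set (Finset ℕ)} (f : B → Q) : Prop :=
  ∃ s t : B, Shift s.1 t.1 ∧ f s ≤ f t

/-- `Q` is `α`-better-quasi-ordered: every map into `Q` from a barrier of order type at most `α`
is good. -/
def IsAlphaBqo (α : Ordinal.{0}) (Q : Type*) [Preorder Q] : Prop :=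
  ∀ B : Set (Finset ℕ), IsBarrier B → LexTypeLE B α → ∀ f : B → Q, IsGood f

/-- The type of the `n`-element maximal antichains of `P`. -/
@[ext] structure AM (n : ℕ) (P : Type*) [PartialOrder P] where
  carrier : Set P
  isMaxAntichain : IsMaxAntichain (· ≤ ·) carrier
  encard_eq : carrier.encard = n

/-- The domination order on the `n`-element maximal antichains: `X ≤ Y` if every element of `X`
is below some element of `Y`. -/
instance (n : ℕ) (P : Type*) [PartialOrder P] : PartialOrder (AM n P) where
  le X Y := ∀ x ∈ X.carrier, ∃ y ∈ Y.carrier, x ≤ y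
  le_refl X x hx := ⟨x, hx, le_rfl⟩
  le_trans X Y Z hXY hYZ x hx := by
    obtain ⟨y, hy, hxy⟩ := hXY x hx
    obtain ⟨z, hz, hyz⟩ := hYZ y hy
    exact ⟨z, hz, hxy.trans hyz⟩
  le_antisymm X Y hXY hYX := by
    have key : ∀ X Y : AM n P, (∀ x ∈ X.carrier, ∃ y ∈ Y.carrier, x ≤ y) →
        (∀ y ∈ Y.carrier, ∃ x ∈ X.carrier, y ≤ x) → X.carrier ⊆ Y.carrier := by
      intro X Y hXY hYX x hx
      obtain ⟨y, hy, hxy⟩ := hXY x hx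
      obtain ⟨x', hx', hyx'⟩ := hYX y hy
      have hxx' : x = x' := X.isMaxAntichain.1.eq hx hx' (hxy.trans hyx')
      have hyx : x = y := le_antisymm hxy (hxx' ▸ hyx')
      exact hyx ▸ hy
    exact AM.ext (Set.Subset.antisymm (key X Y hXY hYX) (key Y X hYX hXY))

/-- The union of all `n`-element maximal antichains of `P`; as a type it carries the order induced
by `P`. -/
def unionAM (n : ℕ) (P : Type*) [PartialOrder P] : Set P :=
  ⋃ X : AM n P, X.carrier

end BQO

/-!
Galvin's lemma makes any map from a barrier into an `α`-bqo monotone along `◁` on a subbarrier.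
Hence `α`-bqos are closed under finite products, and enumerating antichains reflects the order of
`AM_n(P)` into the `n`-th power of `⋃ AM_n(P)`.

Conversely, let `u` be a bad map into `⋃ AM_2(P)`, and pair each value `u s` with its partner in a
maximal antichain `A s` of size two. On a subbarrier where `A` increases along `◁`, badness forces
each element of `A s` below the element of `A t` in the opposite position whenever `s ◁ t`. Read
the pairs as continuous functions `h X` of an infinite set `X`. Following the alternation along
paths of even and of odd length, both elements of `h W` lie below both elements of `h X` for `X`
far out. On the other hand, for every finite `t` and all `X` far out, the first element of
`h (t ∪ X)` is below no element of `h W`, by induction on `t`: otherwise, by maximality of some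
`h V` with `V` far beyond `W`, prepending the least element of `t` would give a good pair. Let `t`
be an initial segment of the whole domain `M` that determines `h M`; then `h (t ∪ X) = h M` is
below `h W` for `W` far out, a contradiction.
-/

namespace BQO

section InfiniteSubsets

/-- The family `[M]^ω` of infinite subsets of `M`. -/
def infiniteSubsets (M : Set ℕ) : Set (Set ℕ) :=
  {X | X ⊆ M ∧ X.Infinite}

/-- The part of `M` lying strictly above the finite set `t`. The infinite sets `X` with
`X ⊆ above M t` are those for which `t` followed by `X` is increasing. -/
def above (M : Set ℕ) (t : Finset ℕ) : Set ℕ :=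
  {x ∈ M | ∀ y ∈ t, y < x}

variable {M N X : Set ℕ} {s t : Finset ℕ} {a : ℕ}

theorem infiniteSubsets_mono (h : N ⊆ M) : infiniteSubsets N ⊆ infiniteSubsets M :=
  fun _ hX => ⟨hX.1.trans h, hX.2⟩

theorem union_mem_infiniteSubsets (ht : (t : Set ℕ) ⊆ M) (hX : X ∈ infiniteSubsets M) :
    ↑t ∪ X ∈ infiniteSubsets M :=
  ⟨Set.union_subset ht hX.1, hX.2.mono Set.subset_union_right⟩

theorem insert_mem_infiniteSubsets (ha : a ∈ M) (hX : X ∈ infiniteSubsets M) :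
    insert a X ∈ infiniteSubsets M :=
  ⟨Set.insert_subset ha hX.1, hX.2.mono (Set.subset_insert a X)⟩

theorem above_subset (M : Set ℕ) (t : Finset ℕ) : above M t ⊆ M :=
  Set.sep_subset _ _

theorem above_mono (h : N ⊆ M) (t : Finset ℕ) : above N t ⊆ above M t :=
  fun _ hx => ⟨h hx.1, hx.2⟩

theorem above_anti (M : Set ℕ) (h : s ⊆ t) : above M t ⊆ above M s :=
  fun _ hx => ⟨hx.1, fun y hy => hx.2 y (h hy)⟩

theorem above_above (M : Set ℕ) (t : Finset ℕ) : above (above M t) t = above M t :=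
  Set.ext fun _ => ⟨fun hx => hx.1, fun hx => ⟨hx, hx.2⟩⟩

theorem infinite_above (hM : M.Infinite) (t : Finset ℕ) : (above M t).Infinite :=
  (hM.sdiff (Set.finite_Iic (t.sup id))).mono fun _ hx =>
    ⟨hx.1, fun _ hy => (Finset.le_sup (f := id) hy).trans_lt (not_le.1 hx.2)⟩

theorem above_mem_infiniteSubsets (hM : M.Infinite) (t : Finset ℕ) :
    above M t ∈ infiniteSubsets M :=
  ⟨above_subset M t, infinite_above hM t⟩

theorem union_mem_above_of_lt (ht : (t : Set ℕ) ⊆ M) (hat : ∀ y ∈ t, a < y)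
    (hX : X ∈ infiniteSubsets (above M (insert a t))) :
    ↑t ∪ X ∈ infiniteSubsets (above M {a}) :=
  union_mem_infiniteSubsets (fun y hy => ⟨ht hy, by simpa using hat y hy⟩)
    (infiniteSubsets_mono (above_anti M (by simp)) hX)

end InfiniteSubsets

section InitialSegments

variable {s t r : Finset ℕ} {X : Set ℕ}

theorem isInit_union_of_subset_above {M : Set ℕ} (hX : X ⊆ above M t) : IsInit t (↑t ∪ X) := by
  refine ⟨Set.subset_union_left, ?_⟩
  rintro x (hx | hx) y hy hxy
  · exact hx
  · exact absurd hxy (not_le.2 ((hX hx).2 y hy))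

theorem IsInit.trans (hs : IsInit s (r : Set ℕ)) (hr : IsInit r X) : IsInit s X :=
  ⟨hs.1.trans hr.1, fun x hx y hy hxy => hs.2 x (hr.2 x hx y (hs.1 hy) hxy) y hy hxy⟩

theorem IsInit.of_subset (hs : IsInit s X) (hr : IsInit r X) (hsr : s ⊆ r) :
    IsInit s (r : Set ℕ) :=
  ⟨hsr, fun x hx => hs.2 x (hr.1 hx)⟩

theorem IsInit.subset_or_subset (hs : IsInit s X) (ht : IsInit t X) : s ⊆ t ∨ t ⊆ s := by
  by_contra! h
  obtain ⟨a, ha, hat⟩ := Finset.not_subset.1 h.1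
  obtain ⟨b, hb, hbs⟩ := Finset.not_subset.1 h.2
  rcases le_total a b with hab | hab
  · exact hat (ht.2 a (hs.1 ha) b hb hab)
  · exact hbs (hs.2 b (ht.1 hb) a ha hab)

theorem mem_tail {x : ℕ} : x ∈ tail r ↔ x ∈ r ∧ ∃ y ∈ r, y < x :=
  Finset.mem_filter

theorem IsInit.tail (hr : IsInit r X) : IsInit (tail r) {x ∈ X | ∃ y ∈ X, y < x} := by
  constructor
  · intro x hx
    obtain ⟨hxr, y, hy, hyx⟩ := mem_tail.1 hx
    exact ⟨hr.1 hxr, y, hr.1 hy, hyx⟩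
  · rintro x ⟨hx, y, hy, hyx⟩ z hz hxz
    have hxr := hr.2 x hx z (mem_tail.1 hz).1 hxz
    exact mem_tail.2 ⟨hxr, y, hr.2 y hy x hxr hyx.le, hyx⟩

theorem tail_insert {a : ℕ} (hat : ∀ y ∈ t, a < y) : BQO.tail (insert a t) = t := by
  ext x
  simp only [mem_tail, Finset.mem_insert]
  constructor
  · rintro ⟨rfl | hx, y, rfl | hy, hyx⟩
    · exact absurd hyx (lt_irrefl _)
    · exact absurd hyx (hat y hy).not_gt
    · exact hx
    · exact hx
  · exact fun hx => ⟨Or.inr hx, a, Or.inl rfl, hat x hx⟩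

theorem union_tail_of_isInit (hs : s.Nonempty) (hsr : IsInit s (r : Set ℕ)) :
    s ∪ BQO.tail r = r := by
  refine (Finset.union_subset hsr.1 (Finset.filter_subset _ _)).antisymm fun x hx => ?_
  obtain ⟨y, hy⟩ := hs
  rcases le_or_gt x y with hxy | hyx
  · exact Finset.mem_union_left _ (hsr.2 x hx y hy hxy)
  · exact Finset.mem_union_right _ (mem_tail.2 ⟨hx, y, hsr.1 hy, hyx⟩)

theorem Shift.isInit_of_isInit_union (h : Shift s t) (hs : s.Nonempty)
    (hX : IsInit (s ∪ t) X) : IsInit s X ∧ IsInit t {x ∈ X | ∃ y ∈ X, y < x} := by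
  obtain ⟨r, hsr, -, rfl⟩ := h
  rw [union_tail_of_isInit hs hsr] at hX
  exact ⟨hsr.trans hX, hX.tail⟩

end InitialSegments

section Fusion

variable {M : Set ℕ}

theorem exists_mem_infiniteSubsets_forall_finset {ι : Type*} {p : ι → Set ℕ → Prop}
    (anti : ∀ i, Antitone (p i))
    (dense : ∀ i, ∀ N ∈ infiniteSubsets M, ∃ N' ∈ infiniteSubsets N, p i N') (I : Finset ι) :
    ∀ N ∈ infiniteSubsets M, ∃ N' ∈ infiniteSubsets N, ∀ i ∈ I, p i N' := by
  classical
  intro N hN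
  induction I using Finset.induction_on with
  | empty => exact ⟨N, ⟨subset_rfl, hN.2⟩, by simp⟩
  | insert i I _ ih =>
    obtain ⟨N₁, hN₁, hI⟩ := ih
    obtain ⟨N₂, hN₂, hi⟩ := dense i N₁ (infiniteSubsets_mono hN.1 hN₁)
    refine ⟨N₂, infiniteSubsets_mono hN₁.1 hN₂, fun j hj => ?_⟩
    rcases Finset.mem_insert.1 hj with rfl | hj
    · exact hi
    · exact anti j hN₂.1 (hI j hj)

theorem exists_diagonal {p : ℕ → Set ℕ → Prop} (hM : M.Infinite) (anti : ∀ n, Antitone (p n))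
    (dense : ∀ n, ∀ N ∈ infiniteSubsets M, ∃ N' ∈ infiniteSubsets N, p n N') :
    ∃ N ∈ infiniteSubsets M, ∀ n ∈ N, p n (above N {n}) := by
  have exists_next : ∀ N : infiniteSubsets M, ∃ N' : infiniteSubsets M,
      N'.1 ⊆ above N {sInf N.1} ∧ p (sInf N.1) N' := by
    rintro ⟨N, hN⟩
    have hab := above_mem_infiniteSubsets hN.2 {sInf N}
    obtain ⟨N', hN', hp⟩ := dense (sInf N) _ (infiniteSubsets_mono hN.1 hab)
    exact ⟨⟨N', infiniteSubsets_mono (hab.1.trans hN.1) hN'⟩, hN'.1, hp⟩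
  choose next next_subset p_next using exists_next
  let S : ℕ → infiniteSubsets M := fun k => next^[k] ⟨M, subset_rfl, hM⟩
  let a : ℕ → ℕ := fun k => sInf (S k).1
  have S_succ : ∀ k, S (k + 1) = next (S k) := fun k => Function.iterate_succ_apply' next k _
  have S_anti : Antitone fun k => (S k).1 := antitone_nat_of_succ_le fun k => by
    simp only [S_succ]
    exact (next_subset (S k)).trans (above_subset _ _)
  have a_mem : ∀ k, a k ∈ (S k).1 := fun k => Nat.sInf_mem (S k).2.2.nonempty
  have a_mono : StrictMono a := strictMono_nat_of_lt_succ fun k => by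
    have h := a_mem (k + 1)
    rw [S_succ] at h
    exact (next_subset (S k) h).2 _ (Finset.mem_singleton_self _)
  refine ⟨Set.range a, ⟨?_, Set.infinite_range_of_injective a_mono.injective⟩, ?_⟩
  · rintro _ ⟨k, rfl⟩
    exact (S k).2.1 (a_mem k)
  · rintro _ ⟨k, rfl⟩
    refine anti (a k) ?_ (p_next (S k))
    rintro _ ⟨⟨j, rfl⟩, hkj⟩
    rw [← S_succ]
    exact S_anti (a_mono.lt_iff_lt.1 (hkj _ (Finset.mem_singleton_self _))) (a_mem j)

theorem exists_fusion {p : Finset ℕ → Set ℕ → Prop} (hM : M.Infinite)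
    (anti : ∀ t, Antitone (p t))
    (dense : ∀ t, ∀ N ∈ infiniteSubsets M, ∃ N' ∈ infiniteSubsets N, p t N') :
    ∃ N ∈ infiniteSubsets M, ∀ t : Finset ℕ, ↑t ⊆ N → p t (above N t) := by
  obtain ⟨M₀, hM₀, h₀⟩ := dense ∅ M ⟨subset_rfl, hM⟩
  obtain ⟨N, hN, hp⟩ := exists_diagonal (p := fun n N => ∀ t ∈ (Finset.range (n + 1)).powerset,
      p t N) hM₀.2 (fun n N N' hN' h t ht => anti t hN' (h t ht)) fun n N hN =>
    exists_mem_infiniteSubsets_forall_finset anti dense _ N (infiniteSubsets_mono hM₀.1 hN)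
  refine ⟨N, infiniteSubsets_mono hM₀.1 hN, fun t ht => ?_⟩
  rcases t.eq_empty_or_nonempty with rfl | hne
  · exact anti ∅ ((above_subset N ∅).trans hN.1) h₀
  · have hmax := t.max'_mem hne
    refine anti t (above_anti N (Finset.singleton_subset_iff.2 hmax)) (hp _ (ht hmax) t ?_)
    exact Finset.mem_powerset.2 fun x hx =>
      Finset.mem_range.2 (Nat.lt_succ_of_le (t.le_max' x hx))

end Fusion

section Galvin

/-- `N` accepts `t`: continuing `t` by any infinite subset of `N` above it yields a set with an
initial segment in `F` (Galvin and Prikry's terminology, as is *rejects* below). -/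
def Accepts (F : Set (Finset ℕ)) (t : Finset ℕ) (N : Set ℕ) : Prop :=
  ∀ X ∈ infiniteSubsets (above N t), ∃ u ∈ F, IsInit u (↑t ∪ X)

/-- `N` rejects `t`: no infinite subset of `N` accepts `t`. -/
def Rejects (F : Set (Finset ℕ)) (t : Finset ℕ) (N : Set ℕ) : Prop :=
  ∀ N' ∈ infiniteSubsets N, ¬ Accepts F t N'

variable {F : Set (Finset ℕ)} {t : Finset ℕ} {M N : Set ℕ}

theorem accepts_antitone (F : Set (Finset ℕ)) (t : Finset ℕ) : Antitone (Accepts F t) :=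
  fun _ _ h hacc X hX => hacc X (infiniteSubsets_mono (above_mono h t) hX)

theorem rejects_antitone (F : Set (Finset ℕ)) (t : Finset ℕ) : Antitone (Rejects F t) :=
  fun _ _ h hrej N' hN' => hrej N' (infiniteSubsets_mono h hN')

theorem accepts_above_iff : Accepts F t (above N t) ↔ Accepts F t N := by
  simp only [Accepts, above_above]

theorem Rejects.of_above (h : Rejects F t (above N t)) : Rejects F t N := fun N' hN' hacc =>
  h (above N' t) ⟨above_mono hN'.1 t, infinite_above hN'.2 t⟩ (accepts_above_iff.2 hacc)

theorem accepts_of_mem (ht : t ∈ F) (N : Set ℕ) : Accepts F t N := fun _ hX =>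
  ⟨t, ht, isInit_union_of_subset_above hX.1⟩

theorem accepts_of_forall_accepts_insert
    (h : ∀ m ∈ N, (∀ y ∈ t, y < m) ∧ Accepts F (insert m t) N) : Accepts F t N := by
  intro X hX
  have hmin : sInf X ∈ X := Nat.sInf_mem hX.2.nonempty
  have hrest : X \ {sInf X} ∈ infiniteSubsets (above N (insert (sInf X) t)) := by
    refine ⟨fun x hx => ⟨(hX.1 hx.1).1, fun y hy => ?_⟩, hX.2.sdiff (Set.finite_singleton _)⟩
    rcases Finset.mem_insert.1 hy with rfl | hy
    · exact lt_of_le_of_ne (Nat.sInf_le hx.1) (Ne.symm hx.2)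
    · exact (hX.1 hx.1).2 y hy
  obtain ⟨u, hu, hinit⟩ := (h _ (hX.1 hmin).1).2 _ hrest
  have hunion : (↑(insert (sInf X) t) : Set ℕ) ∪ X \ {sInf X} = ↑t ∪ X := by
    rw [Finset.coe_insert, Set.insert_union, ← Set.union_insert, Set.insert_sdiff_singleton,
      Set.insert_eq_of_mem hmin]
  exact ⟨u, hu, hunion ▸ hinit⟩

theorem Rejects.finite_accepts_insert (h : Rejects F t N) :
    {m ∈ above N t | Accepts F (insert m t) N}.Finite := by
  by_contra hinf
  refine h _ ⟨fun m hm => hm.1.1, hinf⟩ (accepts_of_forall_accepts_insert fun m hm => ?_)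
  exact ⟨hm.1.2, accepts_antitone F _ (fun x hx => hx.1.1) hm.2⟩

theorem exists_decides (F : Set (Finset ℕ)) (hM : M.Infinite) :
    ∃ N ∈ infiniteSubsets M, ∀ t : Finset ℕ, ↑t ⊆ N → Accepts F t N ∨ Rejects F t N := by
  obtain ⟨N, hN, h⟩ := exists_fusion (p := fun t N => Accepts F t N ∨ Rejects F t N) hM
    (fun t _ _ hN => Or.imp (accepts_antitone F t hN) (rejects_antitone F t hN))
    fun t N hN => by
      by_cases hrej : Rejects F t N
      · exact ⟨N, ⟨subset_rfl, hN.2⟩, Or.inr hrej⟩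
      · simp only [Rejects, not_forall, not_not] at hrej
        obtain ⟨N', hN', hacc⟩ := hrej
        exact ⟨N', hN', Or.inl hacc⟩
  exact ⟨N, hN, fun t ht => (h t ht).imp accepts_above_iff.1 Rejects.of_above⟩

theorem Rejects.exists_forall_finset (hM : M.Infinite) (h : Rejects F ∅ M) :
    ∃ N ∈ infiniteSubsets M, ∀ t : Finset ℕ, ↑t ⊆ N → Rejects F t N := by
  obtain ⟨D, hD, hdec⟩ := exists_decides F hM
  obtain ⟨N, hN, hins⟩ := exists_fusion (M := D)
    (p := fun t N => ↑t ⊆ D → Rejects F t D → ∀ m ∈ above N t, Rejects F (insert m t) D) hD.2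
    (fun t _ _ hN' hp htD hrej m hm => hp htD hrej m (above_mono hN' t hm)) fun t N hN => by
      by_cases ht : ↑t ⊆ D ∧ Rejects F t D
      · refine ⟨N \ {m ∈ above D t | Accepts F (insert m t) D},
          ⟨Set.sdiff_subset, hN.2.sdiff ht.2.finite_accepts_insert⟩, fun htD _ m hm => ?_⟩
        have hmD : m ∈ D := hN.1 hm.1.1
        refine (hdec _ ?_).resolve_left fun hacc => hm.1.2 ⟨⟨hmD, hm.2⟩, hacc⟩
        rw [Finset.coe_insert]
        exact Set.insert_subset hmD htD
      · exact ⟨N, ⟨subset_rfl, hN.2⟩, fun htD hrej => absurd ⟨htD, hrej⟩ ht⟩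
  refine ⟨N, infiniteSubsets_mono hD.1 hN, fun t ht => rejects_antitone F t hN.1 ?_⟩
  induction t using Finset.induction_on_max with
  | empty => exact rejects_antitone F ∅ hD.1 h
  | insert m t hlt ih =>
    rw [Finset.coe_insert, Set.insert_subset_iff] at ht
    refine hins t ht.2 (ht.2.trans hN.1) (ih ht.2) m ?_
    rw [above_above]
    exact ⟨ht.1, hlt⟩

/-- Galvin's lemma. -/
theorem exists_forall_not_subset_or_forall_exists_isInit (F : Set (Finset ℕ)) (hM : M.Infinite) :
    ∃ N ∈ infiniteSubsets M,
      (∀ s ∈ F, ¬ ↑s ⊆ N) ∨ ∀ X ∈ infiniteSubsets N, ∃ s ∈ F, IsInit s X := by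
  by_cases hrej : Rejects F ∅ M
  · obtain ⟨N, hN, h⟩ := hrej.exists_forall_finset hM
    exact ⟨N, hN, Or.inl fun s hs hsN => h s hsN N ⟨subset_rfl, hN.2⟩ (accepts_of_mem hs N)⟩
  · simp only [Rejects, not_forall, not_not] at hrej
    obtain ⟨N, hN, hacc⟩ := hrej
    exact ⟨N, hN, Or.inr fun X hX => by simpa using hacc X (by simpa [above] using hX)⟩

end Galvin

section Barriers

variable {B C : Set (Finset ℕ)} {M X : Set ℕ} {s t : Finset ℕ}

theorem eq_of_isInit (hB : IsAntichain (· ⊆ ·) B) (hs : s ∈ B) (ht : t ∈ B) (hsX : IsInit s X)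
    (htX : IsInit t X) : s = t := by
  rcases hsX.subset_or_subset htX with h | h
  · exact hB.eq hs ht h
  · exact (hB.eq ht hs h).symm

theorem IsBarrier.nonempty_of_mem (hB : IsBarrier B) (hs : s ∈ B) : s.Nonempty := by
  rw [Finset.nonempty_iff_ne_empty]
  rintro rfl
  exact hB.1.1 (Set.finite_singleton ∅ |>.subset fun t ht =>
    (hB.2.eq hs ht (Finset.empty_subset t)).symm)

theorem infinite_dom (hB : B.Infinite) : (dom B).Infinite := by
  intro h
  refine hB (h.toFinset.powerset.finite_toSet.subset fun s hs => ?_)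
  exact Finset.mem_coe.2 (Finset.mem_powerset.2 fun n hn => h.mem_toFinset.2 ⟨s, hs, hn⟩)

theorem subset_dom (hs : s ∈ B) : (s : Set ℕ) ⊆ dom B :=
  fun _ hn => ⟨s, hs, hn⟩

theorem dom_subset_of_forall_subset (h : ∀ s ∈ B, ↑s ⊆ M) : dom B ⊆ M := by
  rintro n ⟨s, hs, hn⟩
  exact h s hs hn

theorem IsBarrier.restrict (hB : IsBarrier B) (hM : M ∈ infiniteSubsets (dom B)) :
    IsBarrier {s ∈ B | ↑s ⊆ M} := by
  set C : Set (Finset ℕ) := {s ∈ B | ↑s ⊆ M}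
  have exists_isInit : ∀ X ⊆ M, X.Infinite → ∃ s ∈ C, s.Nonempty ∧ IsInit s X := by
    intro X hX hXinf
    obtain ⟨s, hs, hne, hinit⟩ := hB.1.2 X (hX.trans hM.1) hXinf
    exact ⟨s, ⟨hs, hinit.1.trans hX⟩, hne, hinit⟩
  have hdom : dom C ⊆ M := dom_subset_of_forall_subset fun s hs => hs.2
  refine ⟨⟨fun hfin => ?_, fun X hX => exists_isInit X (hX.trans hdom)⟩,
    hB.2.subset fun s hs => hs.1⟩
  have hdomfin : (dom C).Finite :=
    (hfin.biUnion fun s _ => s.finite_toSet).subset fun n ⟨s, hs, hn⟩ => Set.mem_biUnion hs hn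
  obtain ⟨s, hs, ⟨n, hn⟩, hinit⟩ := exists_isInit _ Set.sdiff_subset (hM.2.sdiff hdomfin)
  exact (hinit.1 hn).2 (subset_dom hs hn)

theorem shift_of_isInit (hB : IsAntichain (· ⊆ ·) B) (hs : s ∈ B) (ht : t ∈ B) {a : ℕ}
    (ha : ∀ x ∈ X, a < x) (hsX : IsInit s (insert a X)) (htX : IsInit t X) : Shift s t := by
  have hat : ∀ y ∈ t, a < y := fun y hy => ha y (htX.1 hy)
  have hr : IsInit (insert a t) (insert a X) := by
    refine ⟨by simpa using Set.insert_subset_insert htX.1, ?_⟩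
    rintro x (rfl | hx) y hy hxy
    · exact Finset.mem_insert_self _ _
    · rcases Finset.mem_insert.1 hy with rfl | hy
      · exact absurd (ha x hx) hxy.not_gt
      · exact Finset.mem_insert_of_mem (htX.2 x hx y hy hxy)
  have hnot : ¬ insert a t ⊆ s := fun h => by
    have hts : t = s := hB.eq ht hs ((Finset.subset_insert a t).trans h)
    exact lt_irrefl a (hat a (hts ▸ h (Finset.mem_insert_self a t)))
  refine ⟨insert a t, hsX.of_subset hr ((hsX.subset_or_subset hr).resolve_right hnot), ?_,
    (tail_insert hat).symm⟩
  rintro rfl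
  exact hnot subset_rfl

theorem IsBarrier.exists_shift (hB : IsBarrier B) : ∃ s ∈ B, ∃ t ∈ B, Shift s t := by
  have hdom := infinite_dom hB.1.1
  obtain ⟨a, ha⟩ := hdom.nonempty
  have hX := above_mem_infiniteSubsets hdom {a}
  obtain ⟨t, ht, -, htX⟩ := hB.1.2 _ hX.1 hX.2
  have haX := insert_mem_infiniteSubsets ha hX
  obtain ⟨s, hs, -, hsX⟩ := hB.1.2 _ haX.1 haX.2
  exact ⟨s, hs, t, ht, shift_of_isInit hB.2 hs ht
    (fun x hx => hx.2 a (Finset.mem_singleton_self a)) hsX htX⟩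

/-- The partition theorem of Nash-Williams, for a colouring of the pairs `s ◁ t` of a barrier: it
is Galvin's lemma applied to the unions `s ∪ t`, from which `s` and `t` can be recovered. -/
theorem IsBarrier.exists_homogeneous_subbarrier (hB : IsBarrier B)
    (R : Finset ℕ → Finset ℕ → Prop) :
    ∃ C ⊆ B, IsBarrier C ∧ ((∀ s ∈ C, ∀ t ∈ C, Shift s t → ¬ R s t) ∨
      ∀ s ∈ C, ∀ t ∈ C, Shift s t → R s t) := by
  obtain ⟨M, hM, h⟩ := exists_forall_not_subset_or_forall_exists_isInit
    {r | ∃ s ∈ B, ∃ t ∈ B, Shift s t ∧ R s t ∧ s ∪ t = r} (infinite_dom hB.1.1)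
  have union_subset : ∀ {s t : Finset ℕ}, (s : Set ℕ) ⊆ M → (t : Set ℕ) ⊆ M →
      (↑(s ∪ t) : Set ℕ) ⊆ M := fun hs ht => by
    rw [Finset.coe_union]
    exact Set.union_subset hs ht
  refine ⟨_, Set.sep_subset _ _, hB.restrict hM, h.imp ?_ ?_⟩
  · intro h s hs t ht hst hR
    exact h _ ⟨s, hs.1, t, ht.1, hst, hR, rfl⟩ (union_subset hs.2 ht.2)
  · intro h s hs t ht hst
    have hX := above_mem_infiniteSubsets hM.2 (s ∪ t)
    obtain ⟨_, ⟨s', hs', t', ht', hst', hR, rfl⟩, hinit'⟩ :=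
      h _ (union_mem_infiniteSubsets (union_subset hs.2 ht.2) hX)
    have hinit := isInit_union_of_subset_above (subset_refl (above M (s ∪ t)))
    obtain ⟨hsX, htX⟩ := hst.isInit_of_isInit_union (hB.nonempty_of_mem hs.1) hinit
    obtain ⟨hsX', htX'⟩ := hst'.isInit_of_isInit_union (hB.nonempty_of_mem hs') hinit'
    have hss : s' = s := eq_of_isInit hB.2 hs' hs.1 hsX' hsX
    have htt : t' = t := eq_of_isInit hB.2 ht' ht.1 htX' htX
    rwa [hss, htt] at hR

theorem LexTypeLE.mono {α : Ordinal.{0}} (hB : LexTypeLE B α) (hC : C ⊆ B) : LexTypeLE C α := by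
  obtain ⟨h, hle⟩ := hB
  let e : (fun s t : C => LexLT s.1 t.1) ↪r (fun s t : B => LexLT s.1 t.1) :=
    ⟨⟨Set.inclusion hC, Set.inclusion_injective hC⟩, Iff.rfl⟩
  have hwo : IsWellOrder C (fun s t => LexLT s.1 t.1) := e.isWellOrder
  exact ⟨hwo, (Ordinal.type_le_iff'.2 ⟨e⟩).trans hle⟩

end Barriers

section AlphaBqo

variable {α : Ordinal.{0}}

theorem isAlphaBqo_iff {Q : Type*} [Preorder Q] :
    IsAlphaBqo α Q ↔ ∀ B : Set (Finset ℕ), IsBarrier B → LexTypeLE B α → ∀ f : Finset ℕ → Q,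
      ∃ s ∈ B, ∃ t ∈ B, Shift s t ∧ f s ≤ f t := by
  constructor
  · intro h B hB hα f
    obtain ⟨s, t, hst, hle⟩ := h B hB hα fun s => f s
    exact ⟨s, s.2, t, t.2, hst, hle⟩
  · intro h B hB hα f
    obtain ⟨s₀, hs₀⟩ := hB.1.1.nonempty
    obtain ⟨s, hs, t, ht, hst, hle⟩ :=
      h B hB hα (Function.extend Subtype.val f fun _ => f ⟨s₀, hs₀⟩)
    rw [Function.extend_val_apply hs, Function.extend_val_apply ht] at hle
    exact ⟨⟨s, hs⟩, ⟨t, ht⟩, hst, hle⟩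

theorem IsAlphaBqo.exists_perfect_subbarrier {Q : Type*} [Preorder Q] (hQ : IsAlphaBqo α Q)
    {B : Set (Finset ℕ)} (hB : IsBarrier B) (hα : LexTypeLE B α) (f : Finset ℕ → Q) :
    ∃ C ⊆ B, IsBarrier C ∧ ∀ s ∈ C, ∀ t ∈ C, Shift s t → f s ≤ f t := by
  obtain ⟨C, hCB, hC, h⟩ := hB.exists_homogeneous_subbarrier fun s t => f s ≤ f t
  refine ⟨C, hCB, hC, h.resolve_left fun hbad => ?_⟩
  obtain ⟨s, hs, t, ht, hst, hle⟩ := isAlphaBqo_iff.1 hQ C hC (hα.mono hCB) f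
  exact hbad s hs t ht hst hle

theorem IsAlphaBqo.of_reflecting {Q R : Type*} [Preorder Q] [Preorder R] (hR : IsAlphaBqo α R)
    (g : Q → R) (hg : ∀ x y, g x ≤ g y → x ≤ y) : IsAlphaBqo α Q := by
  intro B hB hα f
  obtain ⟨s, t, hst, hle⟩ := hR B hB hα fun s => g (f s)
  exact ⟨s, t, hst, hg _ _ hle⟩

theorem IsAlphaBqo.pi {ι : Type*} [Finite ι] {Q : ι → Type*} [∀ i, Preorder (Q i)]
    (hQ : ∀ i, IsAlphaBqo α (Q i)) : IsAlphaBqo α (∀ i, Q i) := by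
  classical
  refine isAlphaBqo_iff.2 fun B hB hα f => ?_
  have perfect_on : ∀ I : Finset ι, ∃ C ⊆ B, IsBarrier C ∧
      ∀ i ∈ I, ∀ s ∈ C, ∀ t ∈ C, Shift s t → f s i ≤ f t i := by
    intro I
    induction I using Finset.induction_on with
    | empty => exact ⟨B, subset_rfl, hB, by simp⟩
    | insert i I _ ih =>
      obtain ⟨C, hCB, hC, hI⟩ := ih
      obtain ⟨D, hDC, hD, hi⟩ := (hQ i).exists_perfect_subbarrier hC (hα.mono hCB) fun s => f s i
      refine ⟨D, hDC.trans hCB, hD, fun j hj s hs t ht => ?_⟩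
      rcases Finset.mem_insert.1 hj with rfl | hj
      · exact hi s hs t ht
      · exact hI j hj s (hDC hs) t (hDC ht)
  have := Fintype.ofFinite ι
  obtain ⟨C, hCB, hC, hle⟩ := perfect_on Finset.univ
  obtain ⟨s, hs, t, ht, hst⟩ := hC.exists_shift
  exact ⟨s, hCB hs, t, hCB ht, hst, fun i => hle i (Finset.mem_univ i) s hs t ht hst⟩

end AlphaBqo

section Alternation

open Filter

/-- The filter of infinite subsets of `M` receding to infinity: a property holds eventually if
it holds for all infinite subsets of `M` that lie above some fixed finite set. -/
def recedingFilter (M : Set ℕ) : Filter (Set ℕ) :=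
  ⨅ t : Finset ℕ, 𝓟 (infiniteSubsets (above M t))

theorem eventually_mem_above (M : Set ℕ) (t : Finset ℕ) :
    ∀ᶠ X in recedingFilter M, X ∈ infiniteSubsets (above M t) :=
  mem_iInf_of_mem t (mem_principal_self _)

theorem eventually_mem_infiniteSubsets (M : Set ℕ) :
    ∀ᶠ X in recedingFilter M, X ∈ infiniteSubsets M :=
  (eventually_mem_above M ∅).mono fun _ hX => infiniteSubsets_mono (above_subset M ∅) hX

theorem recedingFilter_neBot {M : Set ℕ} (hM : M.Infinite) : (recedingFilter M).NeBot := by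
  classical
  have hbasis : (recedingFilter M).HasBasis (fun _ => True)
      fun t : Finset ℕ => infiniteSubsets (above M t) :=
    hasBasis_iInf_principal <| directed_of_isDirected_le fun _ _ hst =>
      infiniteSubsets_mono (above_anti M hst)
  exact hbasis.neBot_iff.2 fun {t} _ => ⟨_, subset_rfl, infinite_above hM t⟩

/-- Continuity of `h` on the infinite subsets of `M`, for the discrete topology on the codomain:
each value is determined by a finite initial segment of the argument. -/
def InitDetermined {β : Type*} (M : Set ℕ) (h : Set ℕ → β) : Prop :=
  ∀ W ∈ infiniteSubsets M, ∃ s, IsInit s W ∧ ∀ X ∈ infiniteSubsets M, IsInit s X → h X = h W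

theorem union_le_iterate {P ι : Type*} [Preorder P] {M : Set ℕ} {h : Set ℕ → ι → P} {σ : ι → ι}
    (step : ∀ a ∈ M, ∀ X ∈ infiniteSubsets (above M {a}), ∀ i, h (insert a X) i ≤ h X (σ i))
    {t : Finset ℕ} (ht : ↑t ⊆ M) {X : Set ℕ} (hX : X ∈ infiniteSubsets (above M t)) (i : ι) :
    h (↑t ∪ X) i ≤ h X (σ^[t.card] i) := by
  induction t using Finset.induction_on_min generalizing i with
  | empty => simp
  | insert a t hat ih =>
    rw [Finset.coe_insert, Set.insert_subset_iff] at ht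
    rw [Finset.card_insert_of_notMem fun ha => lt_irrefl a (hat a ha), Finset.coe_insert,
      Set.insert_union, Function.iterate_succ_apply]
    exact (step a ht.1 _ (union_mem_above_of_lt ht.2 hat hX) i).trans
      (ih ht.2 (infiniteSubsets_mono (above_anti M (Finset.subset_insert a t)) hX) (σ i))

variable {P : Type*} [Preorder P] {M : Set ℕ} {h : Set ℕ → Bool → P}

theorem eventually_forall_le
    (step : ∀ a ∈ M, ∀ X ∈ infiniteSubsets (above M {a}), ∀ i, h (insert a X) i ≤ h X !i)
    (hdet : InitDetermined M h) {W : Set ℕ} (hW : W ∈ infiniteSubsets M) :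
    ∀ᶠ X in recedingFilter M, ∀ i j, h W i ≤ h X j := by
  obtain ⟨s, hsW, hs⟩ := hdet W hW
  have hsM : ↑s ⊆ M := hsW.1.trans hW.1
  obtain ⟨a, haM, has⟩ := (infinite_above (hW.2.mono hW.1) s).nonempty
  have haM' : ↑(insert a s) ⊆ M := by
    rw [Finset.coe_insert]
    exact Set.insert_subset haM hsM
  have hsa : IsInit s ↑(insert a s) := by
    rw [Finset.coe_insert, ← Set.union_singleton]
    exact isInit_union_of_subset_above (Set.singleton_subset_iff.2 ⟨haM, has⟩)
  have le_iterate : ∀ t : Finset ℕ, ↑t ⊆ M → IsInit s ↑t →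
      ∀ X ∈ infiniteSubsets (above M t), ∀ i, h W i ≤ h X (not^[t.card] i) := by
    intro t ht hst X hX i
    have hXM := infiniteSubsets_mono (above_subset M t) hX
    rw [← hs _ (union_mem_infiniteSubsets ht hXM) (hst.trans (isInit_union_of_subset_above hX.1))]
    exact union_le_iterate step ht hX i
  -- The sizes of `s` and `insert a s` have opposite parities, so together they reach both values.
  filter_upwards [eventually_mem_above M s, eventually_mem_above M (insert a s)] with X hX hXa i j
  have hle := le_iterate s hsM ⟨subset_rfl, fun x hx _ _ _ => hx⟩ X hX i
  have hle' := le_iterate (insert a s) haM' hsa X hXa i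
  rw [Finset.card_insert_of_notMem fun ha => lt_irrefl a (has a ha),
    Function.iterate_succ_apply'] at hle'
  rcases Bool.eq_or_eq_not j (not^[s.card] i) with rfl | rfl
  exacts [hle, hle']

theorem eventually_forall_not_union_le (hM : M.Infinite)
    (step : ∀ a ∈ M, ∀ X ∈ infiniteSubsets (above M {a}), ∀ i, h (insert a X) i ≤ h X !i)
    (bad : ∀ a ∈ M, ∀ X ∈ infiniteSubsets (above M {a}), ¬ h (insert a X) true ≤ h X true)
    (anti : ∀ X ∈ infiniteSubsets M, ¬ h X true ≤ h X false)
    (maximal : ∀ X ∈ infiniteSubsets M, ∀ p, (∃ i, p ≤ h X i) ∨ ∃ i, h X i ≤ p)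
    (hdet : InitDetermined M h) {t : Finset ℕ} (ht : ↑t ⊆ M) {W : Set ℕ}
    (hW : W ∈ infiniteSubsets M) :
    ∀ᶠ X in recedingFilter M, ∀ j, ¬ h (↑t ∪ X) true ≤ h W j := by
  have hne := recedingFilter_neBot hM
  induction t using Finset.induction_on_min generalizing W with
  | empty =>
    filter_upwards [eventually_mem_infiniteSubsets M, eventually_forall_le step hdet hW]
      with X hX hWX j hle
    rw [Finset.coe_empty, Set.empty_union] at hle
    exact anti X hX (hle.trans (hWX j false))
  | insert a t hat ih =>
    rw [Finset.coe_insert, Set.insert_subset_iff] at ht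
    obtain ⟨V, hV, hWV⟩ :=
      ((eventually_mem_infiniteSubsets M).and (eventually_forall_le step hdet hW)).exists
    filter_upwards [eventually_mem_above M (insert a t), ih ht.2 hV] with X hX hnot j hle
    obtain ⟨i, hi⟩ := (maximal V hV _).resolve_left fun ⟨i, hi⟩ => hnot i hi
    rw [Finset.coe_insert, Set.insert_union] at hle
    exact bad a ht.1 _ (union_mem_above_of_lt ht.2 hat hX) (hle.trans ((hWV j i).trans hi))

theorem exists_insert_le (hM : M.Infinite)
    (step : ∀ a ∈ M, ∀ X ∈ infiniteSubsets (above M {a}), ∀ i, h (insert a X) i ≤ h X !i)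
    (anti : ∀ X ∈ infiniteSubsets M, ¬ h X true ≤ h X false)
    (maximal : ∀ X ∈ infiniteSubsets M, ∀ p, (∃ i, p ≤ h X i) ∨ ∃ i, h X i ≤ p)
    (hdet : InitDetermined M h) :
    ∃ a ∈ M, ∃ X ∈ infiniteSubsets (above M {a}), h (insert a X) true ≤ h X true := by
  by_contra! bad
  have hne := recedingFilter_neBot hM
  have hMM : M ∈ infiniteSubsets M := ⟨subset_rfl, hM⟩
  obtain ⟨s, hsM, hs⟩ := hdet M hMM
  obtain ⟨W, hW, hMW⟩ :=
    ((eventually_mem_infiniteSubsets M).and (eventually_forall_le step hdet hMM)).exists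
  obtain ⟨X, hX, hnot⟩ := ((eventually_mem_above M s).and
    (eventually_forall_not_union_le hM step bad anti maximal hdet hsM.1 hW)).exists
  have hXM := infiniteSubsets_mono (above_subset M s) hX
  have heq := hs _ (union_mem_infiniteSubsets hsM.1 hXM) (isInit_union_of_subset_above hX.1)
  exact hnot true (heq ▸ hMW true true)

end Alternation

section MaximalAntichains

variable {P : Type*} [PartialOrder P] {α : Ordinal.{0}}

theorem exists_le_or_exists_le_of_isMaxAntichain {A : Set P} (hA : IsMaxAntichain (· ≤ ·) A)
    (p : P) : (∃ x ∈ A, p ≤ x) ∨ ∃ x ∈ A, x ≤ p := by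
  by_contra! hp
  have hins : IsAntichain (· ≤ ·) (insert p A) :=
    hA.1.insert (fun x hx _ => hp.2 x hx) fun x hx _ => hp.1 x hx
  have hpA : p ∈ A := hA.2 hins (Set.subset_insert p A) ▸ Set.mem_insert p A
  exact hp.1 p hpA le_rfl

theorem mem_unionAM {n : ℕ} {X : AM n P} {x : P} (hx : x ∈ X.carrier) : x ∈ unionAM n P :=
  Set.mem_iUnion.2 ⟨X, hx⟩

theorem AM.exists_range_fin_eq {n : ℕ} (X : AM n P) :
    ∃ e : Fin n → unionAM n P, Set.range (fun i => (e i : P)) = X.carrier := by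
  have := (Set.finite_of_encard_eq_coe X.encard_eq).to_subtype
  have hcard : Nat.card X.carrier = n := by
    rw [Nat.card_coe_set_eq, Set.ncard, X.encard_eq, ENat.toNat_natCast]
  let e := (Finite.equivFinOfCardEq hcard).symm
  refine ⟨fun i => ⟨e i, mem_unionAM (e i).2⟩, ?_⟩
  change Set.range (Subtype.val ∘ e) = X.carrier
  rw [e.surjective.range_comp, Subtype.range_coe]

theorem isAlphaBqo_AM_of_unionAM {n : ℕ} (h : IsAlphaBqo α (unionAM n P)) :
    IsAlphaBqo α (AM n P) := by
  choose e he using fun X : AM n P => X.exists_range_fin_eq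
  refine (IsAlphaBqo.pi fun _ : Fin n => h).of_reflecting e fun X Y hXY x hx => ?_
  rw [← he X] at hx
  obtain ⟨i, rfl⟩ := hx
  exact ⟨e Y i, he Y ▸ Set.mem_range_self i, hXY i⟩

/-- An enumeration by `Bool` of a two-element maximal antichain, giving access to the partner
`e !i` of each element `e i`. -/
structure IsPairing (X : AM 2 P) (e : Bool → P) : Prop where
  injective : Function.Injective e
  range_eq : Set.range e = X.carrier

theorem exists_isPairing {x : P} (hx : x ∈ unionAM 2 P) :
    ∃ (X : AM 2 P) (e : Bool → P), IsPairing X e ∧ e true = x := by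
  obtain ⟨X, hX⟩ := Set.mem_iUnion.1 hx
  obtain ⟨y, z, hyz, hXyz⟩ := Set.encard_eq_two.1 (by simpa using X.encard_eq)
  rw [hXyz] at hX
  rcases hX with rfl | rfl
  · exact ⟨X, fun i => bif i then x else z, ⟨by simp [Bool.injective_iff, hyz.symm], by
      rw [Bool.range_eq, hXyz, Set.pair_comm]; rfl⟩, rfl⟩
  · exact ⟨X, fun i => bif i then x else y, ⟨by simp [Bool.injective_iff, hyz], by
      rw [Bool.range_eq, hXyz]; rfl⟩, rfl⟩

namespace IsPairing

variable {X Y : AM 2 P} {e e' : Bool → P}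

theorem not_le_not (he : IsPairing X e) (i : Bool) : ¬ e i ≤ e !i :=
  X.isMaxAntichain.1 (he.range_eq ▸ Set.mem_range_self i) (he.range_eq ▸ Set.mem_range_self _)
    (he.injective.ne (by simp))

theorem exists_le_or_exists_le (he : IsPairing X e) (p : P) :
    (∃ i, p ≤ e i) ∨ ∃ i, e i ≤ p := by
  simpa only [← he.range_eq, Set.exists_range_iff] using
    exists_le_or_exists_le_of_isMaxAntichain X.isMaxAntichain p

theorem exists_le_of_le (he : IsPairing X e) (he' : IsPairing Y e') (hXY : X ≤ Y) (i : Bool) :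
    ∃ j, e i ≤ e' j := by
  obtain ⟨y, hy, hle⟩ := hXY (e i) (he.range_eq ▸ Set.mem_range_self i)
  rw [← he'.range_eq] at hy
  obtain ⟨j, rfl⟩ := hy
  exact ⟨j, hle⟩

theorem le_not_of_le (he : IsPairing X e) (he' : IsPairing Y e') (hXY : X ≤ Y)
    (hbad : ¬ e true ≤ e' true) (i : Bool) : e i ≤ e' !i := by
  have htrue : e true ≤ e' false := by
    obtain ⟨_ | _, hj⟩ := he.exists_le_of_le he' hXY true
    exacts [hj, absurd hj hbad]
  cases i with
  | true => exact htrue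
  | false =>
    obtain ⟨_ | _, hj⟩ := he.exists_le_of_le he' hXY false
    · -- Now `e' false` bounds `X`, so its partner `e' true` must lie above an element of `X`.
      have hbound : ∀ i, e i ≤ e' false := Bool.forall_bool.2 ⟨hj, htrue⟩
      obtain ⟨i, hi⟩ | ⟨_ | _, hi⟩ := he.exists_le_or_exists_le (e' true)
      · exact absurd (hi.trans (hbound i)) (he'.not_le_not true)
      · exact hi
      · exact absurd hi hbad
    · exact hj

end IsPairing

theorem isAlphaBqo_unionAM_two (h : IsAlphaBqo α (AM 2 P)) : IsAlphaBqo α (unionAM 2 P) := by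
  refine isAlphaBqo_iff.2 fun B hB hα u => ?_
  by_contra! bad
  choose A e he hu using fun s : Finset ℕ => exists_isPairing (u s).2
  obtain ⟨C, hCB, hC, hle⟩ := h.exists_perfect_subbarrier hB hα A
  have exists_init : ∀ X ∈ infiniteSubsets (dom C), ∃ s ∈ C, IsInit s X := fun X hX => by
    obtain ⟨s, hs, -, hsX⟩ := hC.1.2 X hX.1 hX.2
    exact ⟨s, hs, hsX⟩
  choose! β hβC hβ using exists_init
  have shift : ∀ a ∈ dom C, ∀ X ∈ infiniteSubsets (above (dom C) {a}),
      β (insert a X) ∈ C ∧ β X ∈ C ∧ Shift (β (insert a X)) (β X) := by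
    intro a ha X hX
    have hXC := infiniteSubsets_mono (above_subset _ _) hX
    have haX := insert_mem_infiniteSubsets ha hXC
    exact ⟨hβC _ haX, hβC X hXC, shift_of_isInit hC.2 (hβC _ haX) (hβC X hXC)
      (fun x hx => (hX.1 hx).2 a (Finset.mem_singleton_self a)) (hβ _ haX) (hβ X hXC)⟩
  have not_le : ∀ s ∈ C, ∀ t ∈ C, Shift s t → ¬ e s true ≤ e t true := by
    intro s hs t ht hst hle
    rw [hu, hu] at hle
    exact bad s (hCB hs) t (hCB ht) hst hle
  obtain ⟨a, ha, X, hX, hbad⟩ := exists_insert_le (h := fun X => e (β X)) (infinite_dom hC.1.1)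
    (fun a ha X hX => by
      obtain ⟨hs, ht, hst⟩ := shift a ha X hX
      exact (he _).le_not_of_le (he _) (hle _ hs _ ht hst) (not_le _ hs _ ht hst))
    (fun X _ => (he _).not_le_not true) (fun X _ => (he _).exists_le_or_exists_le)
    fun W hW => ⟨β W, hβ W hW, fun X hX hWX =>
      congrArg e (eq_of_isInit hC.2 (hβC X hX) (hβC W hW) (hβ X hX) hWX)⟩
  obtain ⟨hs, ht, hst⟩ := shift a ha X hX
  exact not_le _ hs _ ht hst hbad

end MaximalAntichains

end BQO

theorem theorem6p3_general {P : Type*} [PartialOrder P] (α : Ordinal.{0}) :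
    BQO.IsAlphaBqo α (BQO.AM 2 P) ↔ BQO.IsAlphaBqo α (BQO.unionAM 2 P) :=
  ⟨BQO.isAlphaBqo_unionAM_two, BQO.isAlphaBqo_AM_of_unionAM⟩

theorem theorem6p3 {P : Type*} [PartialOrder P]
    (hP : ∀ A : Set P, IsAntichain (· ≤ ·) A → A.Finite)
    (α : Ordinal.{0}) (hα : α.card ≤ Cardinal.aleph0) :
    BQO.IsAlphaBqo α (BQO.AM 2 P) ↔ BQO.IsAlphaBqo α (BQO.unionAM 2 P) :=
  theorem6p3_general α
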